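/- Let $n\in\{2,3\}$ and let $\Omega\subset\mathbb R^n$ be a bounded domain that is decomposed by flat fractures and their intersections into finitely many pairwise disjoint subdomains $\Omega^d_i$ ($0\le d\le n$, $i\in I^d$), each a relatively open subset of a $d$-dimensional plane; let $\partial\Omega_N\subseteq\partial\Omega$ be the no-flux part of the boundary. An interface $\Gamma^d_j$ ($0\le d\le n-1$) is a copy of some $\Omega^d_i$, regarded as a part of the boundary of an adjacent $\Omega^{d+1}_k$ seen from one side, with unit normal $\nu$ outward from $\Omega^{d+1}_k$. Let $\mathcal T^d_\Omega$ be conforming simplicial meshes of the $d$-dimensional subdomains that resolve the interfaces and $\partial\Omega_N$, and let $\mathcal T^d_\Gamma$ be arbitrary simplicial (mortar) meshes of the interfaces. The mesh $\mathcal T_\Omega$ is called $\sigma$-shape-regular if $\operatorname{diam}T\le\sigma\rho_T$ for every element $T$ of dimension at least $1$, where $\rho_T$ is the diameter of the inscribed ball of $T$. On every $\Omega^d_i$, $d\ge1$, let $K$ be a constant symmetric positive definite tensor on the tangent space, and let $\kappa\ge 1$ be such that on each subdomain the largest eigenvalue of $K$ is at most $\kappa$ times the smallest; thus $\kappa=1$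 is allowed if and only if $K$ is a scalar multiple of the identity on each subdomain. On every interface let $\gamma>0$ be constant and let $K_\nu$ be a measurable function bounded above and below by positive constants. For $1\le d\le n$ let $V^d_h=\mathbb{RT}_0(\mathcal T^d_\Omega)$ be the lowest-order Raviart–Thomas space of fields with $v\cdot\nu=0$ on $\partial\Omega_N$, with normal components continuous across the facets inside each subdomain; let $V^d_{0h}\subseteq V^d_h$ consist of the fields with zero normal component on the interfaces, let $\Lambda^d_h=\mathbb P_0(\mathcal T^d_\Gamma)$, $\Lambda_h=\bigoplus_{d=0}^{n-1}\Lambda_h^d$ and $W_h=\bigl(\bigoplus_{d=1}^n V^d_{0h}\bigr)\times\Lambda_h$. Let $R_h=\bigoplus_d R^d_h$ with $R^d_h:\Lambda^d_h\to V^{d+1}_h$ be a linear discrete extension operator: the normal trace of $R^d_h\mu$ on the $d$-dimensional interfaces is the $L^2$-projection of $\mu$ onto the space of normal traces of $V^{d+1}_h$, and its normal component vanishes on the rest of the boundary of the $(d+1)$-dimensional subdomains. For $r=[v_0,\mu]\in W_h$ put $v=v_0+R_h\mu$ and $$\|r\|_a^2=\sum_{d=1}^n\sum_{T\in\mathcal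 T^d_\Omega}(K^{-1}v,v)_{T}+(\gamma K_\nu^{-1}\mu,\mu)_\Gamma,$$ $$\|r\|_{a^D}^2=\sum_{d=1}^n\sum_{T\in\mathcal T^d_\Omega}\sum_{f\subset\partial T}(v\cdot\nu_f)^2\,(K^{-1}\phi_f,\phi_f)_T+(\gamma K_\nu^{-1}\mu,\mu)_\Gamma,$$ where $\nu_f$ is the unit outer normal of the facet $f$ of $T$ and $\phi_f\in\mathbb{RT}_0(T)$ is the basis function with normal component $1$ on $f$ and $0$ on the other facets of $T$. Then for every $\sigma$ there are constants $c_1,c_2>0$, depending only on $\sigma$, such that for all such data with a $\sigma$-shape-regular mesh $\mathcal T_\Omega$ and all $r\in W_h$ $$\frac{c_1}{\sqrt{\kappa}}\,\|r\|_{a^D}\le\|r\|_a\le c_2\,\|r\|_{a^D}.$$ In particular, if $K$ is a scalar multiple of the identity on each subdomain, then $c_1\|r\|_{a^D}\le\|r\|_a\le c_2\|r\|_{a^D}$, with constants that depend on the shape regularity of $\mathcal T_\Omega$ only. -/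

import Mathlib

open MeasureTheory Set
open scoped RealInnerProductSpace Topology

noncomputable section

namespace MixedDim

/-- The ambient Euclidean space `ℝⁿ`. -/
abbrev E (n : ℕ) : Type := EuclideanSpace ℝ (Fin n)

section Simplex

variable {n d : ℕ}

/-- The relative interior of a simplex: all barycentric coordinates are positive.
For a `0`-simplex this is the point itself. -/
def relInt (S : Affine.Simplex ℝ (E n) d) : Set (E n) :=
  S.setInterior (Ioi 0)

/-- The relative interior of the facet of `S` opposite to the vertex `k`. -/
def facetInt (S : Affine.Simplex ℝ (E n) (d + 1)) (k : Fin (d + 2)) : Set (E n) :=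
  relInt (S.faceOpposite k)

/-- The unit outer normal (within the plane of `S`) of the facet of `S` opposite to the vertex `k`:
it points from the vertex `k` to the foot of the altitude through that vertex. -/
def outerNormal (S : Affine.Simplex ℝ (E n) (d + 1)) (k : Fin (d + 2)) : E n :=
  (S.height k)⁻¹ • (S.altitudeFoot k - S.points k)

/-- The local lowest-order Raviart-Thomas space on `S`: the fields `x ↦ a + b (x - x₀)` with `a`
tangential to `S`, `b` a number and `x₀` a vertex of `S`. -/
def RT0 (S : Affine.Simplex ℝ (E n) (d + 1)) : Submodule ℝ (E n → E n) where
  carrier := {v | ∃ a ∈ vectorSpan ℝ (range S.points), ∃ b : ℝ,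
    ∀ x, v x = a + b • (x - S.points 0)}
  add_mem' := by
    rintro v w ⟨a, ha, b, hv⟩ ⟨a', ha', b', hw⟩
    refine ⟨a + a', add_mem ha ha', b + b', fun x => ?_⟩
    rw [Pi.add_apply, hv, hw]
    module
  zero_mem' := ⟨0, zero_mem _, 0, fun x => by simp⟩
  smul_mem' := by
    rintro c v ⟨a, ha, b, hv⟩
    refine ⟨c • a, Submodule.smul_mem _ c ha, c * b, fun x => ?_⟩
    rw [Pi.smul_apply, hv]
    module

/-- The Raviart-Thomas basis function of the facet opposite to the vertex `k`: its normal component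
is `1` on that facet and `0` on all other facets of `S`. -/
def rtBasis (S : Affine.Simplex ℝ (E n) (d + 1)) (k : Fin (d + 2)) : E n → E n :=
  fun x => (S.height k)⁻¹ • (x - S.points k)

/-- The outer normal component `v · ν` of `v` on the facet opposite to the vertex `k`. It is
constant on the facet for `v` in `RT0 S`, and evaluated here at the centroid of the facet. -/
def flux (S : Affine.Simplex ℝ (E n) (d + 1)) (k : Fin (d + 2)) (v : E n → E n) : ℝ :=
  ⟪v (S.faceOppositeCentroid k), outerNormal S k⟫

end Simplex

/-- `Adjacent P A Q B ν`: the set `A`, in the plane `P`, is a part of the boundary of the set `B`,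
in the plane `Q`, and `B` lies on the side of `A` for which `ν` is the outward unit normal. -/
def Adjacent {n : ℕ} (P : AffineSubspace ℝ (E n)) (A : Set (E n))
    (Q : AffineSubspace ℝ (E n)) (B : Set (E n)) (ν : E n) : Prop :=
  ν ∈ Q.direction ∧ ν ∈ P.directionᗮ ∧ ‖ν‖ = 1 ∧
    ∀ x ∈ A, ∀ᶠ s : ℝ in 𝓝[>] 0, x - s • ν ∈ B

/-- The dimensional decomposition of a fractured porous medium in `ℝⁿ`. -/
structure Geometry (n : ℕ) where
  /-- the whole medium -/
  domain : Set (E n)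
  domain_open : IsOpen domain
  domain_bounded : Bornology.IsBounded domain
  domain_connected : IsConnected domain
  /-- the part of the outer boundary with the no-flux condition (the rest is the Dirichlet part) -/
  neumann : Set (E n)
  neumann_subset : neumann ⊆ frontier domain
  /-- the index sets of the `d`-dimensional subdomains -/
  I : ℕ → Type
  [finI : ∀ d, Fintype (I d)]
  /-- the plane of a subdomain -/
  plane : ∀ d, I d → AffineSubspace ℝ (E n)
  finrank_plane : ∀ d i, Module.finrank ℝ (plane d i).direction = d
  /-- the subdomains, relatively open in their planes -/
  dom : ∀ d, I d → Set (E n)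
  dom_nonempty : ∀ d i, (dom d i).Nonempty
  dom_open : ∀ d i, ∃ U, IsOpen U ∧ dom d i = U ∩ (plane d i : Set (E n))
  dom_subset : ∀ d i, dom d i ⊆ domain
  dom_disjoint : ∀ (p q : Σ d, I d), p ≠ q → Disjoint (dom p.1 p.2) (dom q.1 q.2)
  /-- up to fractures the subdomains of full dimension make up the medium -/
  dom_dense : domain ⊆ closure (⋃ i : I n, dom n i)
  /-- the index sets of the `d`-dimensional interfaces -/
  J : ℕ → Type
  [finJ : ∀ d, Fintype (J d)]
  /-- the `d`-dimensional subdomain with which an interface coincides as a set -/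
  lo : ∀ {d}, J d → I d
  /-- the `(d + 1)`-dimensional subdomain of whose boundary an interface is a part -/
  hi : ∀ {d}, J d → I (d + 1)
  /-- the unit normal on an interface, outward from the `(d + 1)`-dimensional subdomain; the two
  sides of a fracture inside one subdomain are two interfaces with opposite normals -/
  normal : ∀ {d}, J d → E n
  adjacent : ∀ {d} (f : J d), Adjacent (plane d (lo f)) (dom d (lo f))
    (plane (d + 1) (hi f)) (dom (d + 1) (hi f)) (normal f)
  interface_unique : ∀ {d} (f g : J d), lo f = lo g → hi f = hi g → normal f = normal g → f = g
  interface_complete : ∀ {d} (i : I d) (j : I (d + 1)) (ν : E n),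
    Adjacent (plane d i) (dom d i) (plane (d + 1) j) (dom (d + 1) j) ν →
      ∃ f : J d, lo f = i ∧ hi f = j ∧ normal f = ν

attribute [instance] Geometry.finI Geometry.finJ

/-- The set underlying an interface. -/
def Geometry.Gam {n : ℕ} (G : Geometry n) {d : ℕ} (f : G.J d) : Set (E n) :=
  G.dom d (G.lo f)

/-- A finite triangulation by `d`-simplices of a relatively open set `A` in a `d`-plane of `ℝⁿ`.
Conformity is required inside `A` only, so the two sides of a slit in `A` need not match. -/
structure Triangulation (n d : ℕ) (A : Set (E n)) where
  Elem : Type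
  [fin : Fintype Elem]
  simplex : Elem → Affine.Simplex ℝ (E n) d
  relInt_subset : ∀ t, relInt (simplex t) ⊆ A
  cover : A ⊆ ⋃ t, (simplex t).closedInterior
  disjoint : ∀ s t, s ≠ t → Disjoint (relInt (simplex s)) (relInt (simplex t))
  conforming : ∀ s t, s ≠ t →
    (simplex s).closedInterior ∩ (simplex t).closedInterior ∩ A ⊆
      convexHull ℝ (range (simplex s).points ∩ range (simplex t).points)

attribute [instance] Triangulation.fin

/-- The facet of `S` opposite to the vertex `k` lies on the interface `f`, with `S` on the side of
the higher-dimensional subdomain. -/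
def Geometry.OnInterface {n : ℕ} (G : Geometry n) {d : ℕ} (f : G.J d)
    (S : Affine.Simplex ℝ (E n) (d + 1)) (k : Fin (d + 2)) : Prop :=
  facetInt S k ⊆ G.Gam f ∧ outerNormal S k = G.normal f

/-- The meshes of the subdomains, and the mortar meshes of the interfaces. The facets of the
subdomain meshes resolve the boundaries of the subdomains, the interfaces and the Neumann boundary;
the mortar meshes are not related to the subdomain meshes. -/
structure Mesh {n : ℕ} (G : Geometry n) where
  sub : ∀ d (i : G.I d), Triangulation n d (G.dom d i)
  mortar : ∀ d (f : G.J d), Triangulation n d (G.Gam f)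
  resolves_dom : ∀ d (i : G.I (d + 1)) t k,
    facetInt ((sub (d + 1) i).simplex t) k ⊆ G.dom (d + 1) i ∨
      Disjoint (facetInt ((sub (d + 1) i).simplex t) k) (G.dom (d + 1) i)
  resolves_interface : ∀ d (f : G.J d) t k,
    facetInt ((sub (d + 1) (G.hi f)).simplex t) k ⊆ G.Gam f ∨
      Disjoint (facetInt ((sub (d + 1) (G.hi f)).simplex t) k) (G.Gam f)
  resolves_neumann : ∀ d (i : G.I (d + 1)) t k,
    facetInt ((sub (d + 1) i).simplex t) k ⊆ G.neumann ∨
      Disjoint (facetInt ((sub (d + 1) i).simplex t) k) G.neumann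

/-- The physical parameters: the permeability `K`, a symmetric positive definite tensor on the
tangent space of each subdomain of positive dimension, constant on the subdomain; the distances `γ`,
constant on each interface; and the normal permeability `Kν` on the interfaces. -/
structure Parameters {n : ℕ} (G : Geometry n) where
  K : ∀ d (i : G.I (d + 1)),
    (G.plane (d + 1) i).direction ≃ₗ[ℝ] (G.plane (d + 1) i).direction
  K_symm : ∀ d i x y, ⟪K d i x, y⟫ = ⟪x, K d i y⟫
  K_pos : ∀ d i x, x ≠ 0 → 0 < ⟪K d i x, x⟫
  γ : ∀ d, G.J d → ℝ
  γ_pos : ∀ d f, 0 < γ d f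
  Kν : ∀ d, G.J d → E n → ℝ
  Kν_measurable : ∀ d f, Measurable (Kν d f)
  Kν_bounds : ∀ d f, ∃ m M : ℝ, 0 < m ∧ ∀ x ∈ G.Gam f, m ≤ Kν d f x ∧ Kν d f x ≤ M

/-- On each subdomain the largest eigenvalue of `K` is at most `κ` times the smallest one. For
`κ = 1` this says that `K` is a scalar multiple of the identity on each subdomain. -/
def Parameters.AnisotropyLE {n : ℕ} {G : Geometry n} (P : Parameters G) (κ : ℝ) : Prop :=
  ∀ d (i : G.I (d + 1)), ∃ k : ℝ, 0 < k ∧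
    ∀ x, k * ‖x‖ ^ 2 ≤ ⟪P.K d i x, x⟫ ∧ ⟪P.K d i x, x⟫ ≤ κ * k * ‖x‖ ^ 2

namespace Mesh

variable {n : ℕ} {G : Geometry n} (M : Mesh G)

/-- The subdomain mesh is shape regular with constant `σ`: the diameter of every element of
positive dimension is at most `σ` times the diameter of its inscribed ball. -/
def ShapeRegular (σ : ℝ) : Prop :=
  ∀ d (i : G.I (d + 1)) t,
    Metric.diam ((M.sub (d + 1) i).simplex t).closedInterior ≤
      σ * (2 * ((M.sub (d + 1) i).simplex t).inradius)

/-- Elementwise vector fields on the `(d + 1)`-dimensional subdomain meshes. -/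
abbrev Field (d : ℕ) : Type :=
  ∀ i : G.I (d + 1), (M.sub (d + 1) i).Elem → E n → E n

/-- The mortar space of the `d`-dimensional interfaces: piecewise constants on the mortar mesh. -/
abbrev Lam (d : ℕ) : Type :=
  ∀ f : G.J d, (M.mortar d f).Elem → ℝ

/-- The Raviart-Thomas space on the `(d + 1)`-dimensional subdomains: elementwise Raviart-Thomas
fields with continuous normal components across all facets inside a subdomain, and vanishing
normal component on the Neumann boundary. -/
def Vh (d : ℕ) : Submodule ℝ (M.Field d) where
  carrier := {v |
    (∀ i t, v i t ∈ RT0 ((M.sub (d + 1) i).simplex t)) ∧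
    (∀ i s t k l, s ≠ t →
      range (((M.sub (d + 1) i).simplex s).faceOpposite k).points =
        range (((M.sub (d + 1) i).simplex t).faceOpposite l).points →
      facetInt ((M.sub (d + 1) i).simplex s) k ⊆ G.dom (d + 1) i →
      flux ((M.sub (d + 1) i).simplex s) k (v i s) +
        flux ((M.sub (d + 1) i).simplex t) l (v i t) = 0) ∧
    (∀ i t k, facetInt ((M.sub (d + 1) i).simplex t) k ⊆ G.neumann →
      flux ((M.sub (d + 1) i).simplex t) k (v i t) = 0)}
  add_mem' := by
    rintro v w ⟨h1, h2, h3⟩ ⟨g1, g2, g3⟩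
    refine ⟨fun i t => add_mem (h1 i t) (g1 i t), fun i s t k l hst hr hk => ?_,
      fun i t k hk => ?_⟩
    · have h := h2 i s t k l hst hr hk
      have g := g2 i s t k l hst hr hk
      simp only [flux, Pi.add_apply, inner_add_left] at h g ⊢
      linarith
    · have h := h3 i t k hk
      have g := g3 i t k hk
      simp only [flux, Pi.add_apply, inner_add_left] at h g ⊢
      linarith
  zero_mem' := ⟨fun i t => zero_mem _, fun i s t k l _ _ _ => by simp [flux],
    fun i t k _ => by simp [flux]⟩
  smul_mem' := by
    rintro c v ⟨h1, h2, h3⟩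
    refine ⟨fun i t => Submodule.smul_mem _ c (h1 i t), fun i s t k l hst hr hk => ?_,
      fun i t k hk => ?_⟩
    · have h := h2 i s t k l hst hr hk
      simp only [flux, Pi.smul_apply, real_inner_smul_left] at h ⊢
      rw [← mul_add, h, mul_zero]
    · have h := h3 i t k hk
      simp only [flux, Pi.smul_apply, real_inner_smul_left] at h ⊢
      rw [h, mul_zero]

/-- The subspace of `Vh` of the fields with vanishing normal component on the interfaces. -/
def V0h (d : ℕ) : Submodule ℝ (M.Field d) where
  carrier := {v | v ∈ M.Vh d ∧ ∀ (f : G.J d) t k,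
    G.OnInterface f ((M.sub (d + 1) (G.hi f)).simplex t) k →
      flux ((M.sub (d + 1) (G.hi f)).simplex t) k (v (G.hi f) t) = 0}
  add_mem' := by
    rintro v w ⟨hv, h⟩ ⟨hw, g⟩
    refine ⟨add_mem hv hw, fun f t k hk => ?_⟩
    have h := h f t k hk
    have g := g f t k hk
    simp only [flux, Pi.add_apply, inner_add_left] at h g ⊢
    linarith
  zero_mem' := ⟨zero_mem _, fun f t k _ => by simp [flux]⟩
  smul_mem' := by
    rintro c v ⟨hv, h⟩
    refine ⟨Submodule.smul_mem _ c hv, fun f t k hk => ?_⟩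
    have h := h f t k hk
    simp only [flux, Pi.smul_apply, real_inner_smul_left] at h ⊢
    rw [h, mul_zero]

/-- All pairs of an elementwise vector field and a mortar function, over all dimensions. -/
abbrev Flux : Type := (∀ d, M.Field d) × (∀ d, M.Lam d)

/-- The space `W_h` of the discrete flux variables `[v₀, μ]`. -/
def Wh : Submodule ℝ M.Flux :=
  (Submodule.pi univ fun d => M.V0h d).prod ⊤

/-- The function on the interface `f` given by the element values of a mortar function. -/
def mortarFun {d : ℕ} (μ : M.Lam d) (f : G.J d) : E n → ℝ :=
  fun x => ∑ m, (relInt ((M.mortar d f).simplex m)).indicator (fun _ => μ f m) x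

open Classical in
/-- The normal trace `v · ν` on the interface `f`, a function constant on each facet of the
adjacent subdomain mesh that lies on `f`. -/
def normalTrace {d : ℕ} (v : M.Field d) (f : G.J d) : E n → ℝ :=
  fun x => ∑ t, ∑ k,
    if G.OnInterface f ((M.sub (d + 1) (G.hi f)).simplex t) k then
      (facetInt ((M.sub (d + 1) (G.hi f)).simplex t) k).indicator
        (fun _ => flux ((M.sub (d + 1) (G.hi f)).simplex t) k (v (G.hi f) t)) x
    else 0

/-- `g` is the `L²`-projection of the mortar function `μ` onto the space of the normal traces on
the `d`-dimensional interfaces of the fields in `Vh`. -/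
def IsProjection {d : ℕ} (μ : M.Lam d) (g : G.J d → E n → ℝ) : Prop :=
  (∃ v ∈ M.Vh d, ∀ f, g f = M.normalTrace v f) ∧
    ∀ w ∈ M.Vh d, ∑ f : G.J d,
      ∫ x in G.Gam f, (g f x - M.mortarFun μ f x) * M.normalTrace w f x ∂μHE[d] = 0

/-- `R` is a discrete extension operator: `R μ` lies in `Vh`, its normal trace on the interfaces is
the `L²`-projection of `μ`, and its normal component vanishes elsewhere on the boundaries of the
subdomains. -/
def IsExtension (R : ∀ d, M.Lam d →ₗ[ℝ] M.Field d) : Prop :=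
  ∀ d (μ : M.Lam d), R d μ ∈ M.Vh d ∧ M.IsProjection μ (M.normalTrace (R d μ)) ∧
    ∀ i t k, Disjoint (facetInt ((M.sub (d + 1) i).simplex t) k) (G.dom (d + 1) i) →
      (∀ f : G.J d, G.hi f = i → ¬ G.OnInterface f ((M.sub (d + 1) i).simplex t) k) →
      flux ((M.sub (d + 1) i).simplex t) k (R d μ i t) = 0

variable (P : Parameters G)

/-- `(K⁻¹ u, w)_T` for an element `T`. The fields are tangential to `T`; the orthogonal projections
onto the tangent space only change their type. -/
def massElem {d : ℕ} (i : G.I (d + 1)) (t : (M.sub (d + 1) i).Elem) (u w : E n → E n) : ℝ :=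
  ∫ x in ((M.sub (d + 1) i).simplex t).closedInterior,
    ⟪(P.K d i).symm ((G.plane (d + 1) i).direction.orthogonalProjectionOnto (u x)),
      (G.plane (d + 1) i).direction.orthogonalProjectionOnto (w x)⟫ ∂μHE[d + 1]

/-- `(K⁻¹ u, w)_Ω`; points do not contribute. -/
def mass (u w : ∀ d, M.Field d) : ℝ :=
  ∑ d ∈ Finset.range n, ∑ i : G.I (d + 1), ∑ t, M.massElem P i t (u d i t) (w d i t)

/-- The diagonal version `(K⁻¹ u, w)_{D,Ω}`. -/
def massD (u w : ∀ d, M.Field d) : ℝ :=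
  ∑ d ∈ Finset.range n, ∑ i : G.I (d + 1), ∑ t, ∑ k,
    flux ((M.sub (d + 1) i).simplex t) k (u d i t) *
      flux ((M.sub (d + 1) i).simplex t) k (w d i t) *
      M.massElem P i t (rtBasis ((M.sub (d + 1) i).simplex t) k)
        (rtBasis ((M.sub (d + 1) i).simplex t) k)

/-- The mortar term `(γ Kν⁻¹ ρ, μ)_Γ`. -/
def mortarMass (ρ μ : ∀ d, M.Lam d) : ℝ :=
  ∑ d ∈ Finset.range n, ∑ f : G.J d,
    ∫ x in G.Gam f,
      P.γ d f * (P.Kν d f x)⁻¹ * M.mortarFun (ρ d) f x * M.mortarFun (μ d) f x ∂μHE[d]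

/-- The total flux `v₀ + R μ` of `r = [v₀, μ]`. -/
def total (R : ∀ d, M.Lam d →ₗ[ℝ] M.Field d) (r : M.Flux) : ∀ d, M.Field d :=
  fun d => r.1 d + R d (r.2 d)

/-- The bilinear form `a`. -/
def a (R : ∀ d, M.Lam d →ₗ[ℝ] M.Field d) (w r : M.Flux) : ℝ :=
  M.mass P (M.total R w) (M.total R r) + M.mortarMass P w.2 r.2

/-- The bilinear form `a^D`. -/
def aD (R : ∀ d, M.Lam d →ₗ[ℝ] M.Field d) (w r : M.Flux) : ℝ :=
  M.massD P (M.total R w) (M.total R r) + M.mortarMass P w.2 r.2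

/-- The norm induced by `a`. -/
def normA (R : ∀ d, M.Lam d →ₗ[ℝ] M.Field d) (r : M.Flux) : ℝ :=
  Real.sqrt (M.a P R r r)

/-- The norm induced by `a^D`. -/
def normAD (R : ∀ d, M.Lam d →ₗ[ℝ] M.Field d) (r : M.Flux) : ℝ :=
  Real.sqrt (M.aD P R r r)

end Mesh

end MixedDim

end

/-! The mortar term is the same in both norms, so the claim reduces to comparing the local form
`massElem` with its diagonal on a single element; summing over elements keeps the constants. Upper
bound: on a simplex the fields `rtBasis` are dual to the fluxes, so `v` is pointwise the sum of its
fluxes times these fields (`eq_sum_flux_smul_rtBasis`). Cauchy-Schwarz for the quadratic form of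
`K⁻¹` costs only the number of facets, at most 4, for any tensor and any element shape. Lower bound:
a flux is at most the norm of `v` at the facet centroid. As `v` is affine, an inverse estimate
(`sq_norm_mul_measure_le`), obtained by a homothety of ratio 1/2 and free of shape constants, bounds
this by the `L²`-mean of `v`. Shape regularity enters through `norm_rtBasis_le`: the basis fields
are at most `2σ`. Passing between `K⁻¹` and the identity in both factors costs the eigenvalue ratio
`κ`. -/

noncomputable section

namespace MixedDim

/-! ### Integration over a simplex and the inverse estimate for affine maps -/

section Simplex

variable {n d : ℕ}

/-- The restriction of the `d`-dimensional Hausdorff measure to a `d`-simplex is finite. -/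
theorem measure_closedInterior_lt_top (S : Affine.Simplex ℝ (E n) d) :
    μHE[d] S.closedInterior < ⊤ := by
  set W := vectorSpan ℝ (range S.points) with hW
  have hd : Module.finrank ℝ W = d :=
    S.independent.finrank_vectorSpan (by simp)
  -- A translated copy of the tangent space: isometries preserve the Hausdorff measure, and in its
  -- full dimension that measure is finite on compact sets.
  let φ : W → E n := fun w => w + S.points 0
  have hφ : Isometry φ := by
    intro x y
    simp [φ, edist_add_right]
    rfl
  have hsub : S.closedInterior ⊆ range φ := by
    intro x hx
    have hx' := Affine.Simplex.closedInterior_subset_affineSpan hx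
    refine ⟨⟨x - S.points 0, ?_⟩, by simp [φ]⟩
    exact vsub_mem_vectorSpan_of_mem_affineSpan_of_mem_affineSpan hx'
      (mem_affineSpan ℝ (mem_range_self 0))
  have hc : IsCompact (φ ⁻¹' S.closedInterior) :=
    hφ.isClosedEmbedding.isCompact_preimage S.isCompact_closedInterior
  have h := hφ.euclideanHausdorffMeasure_image (d := d) (φ ⁻¹' S.closedInterior)
  rw [image_preimage_eq_of_subset hsub] at h
  rw [h]
  have : (μHE[Module.finrank ℝ W] : Measure W) (φ ⁻¹' S.closedInterior) < ⊤ := hc.measure_lt_top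
  rwa [hd] at this

theorem integrableOn_closedInterior (S : Affine.Simplex ℝ (E n) d) {F : Type*}
    [NormedAddCommGroup F] {g : E n → F} (hg : ContinuousOn g S.closedInterior) :
    IntegrableOn g S.closedInterior μHE[d] := by
  have : IsFiniteMeasure ((μHE[d] : Measure (E n)).restrict S.closedInterior) :=
    ⟨by simpa using measure_closedInterior_lt_top S⟩
  obtain ⟨C, hC⟩ := S.isCompact_closedInterior.exists_bound_of_continuousOn hg
  refine Integrable.of_bound
    (hg.aestronglyMeasurable_of_isCompact S.isCompact_closedInterior
      S.isCompact_closedInterior.measurableSet) C ?_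
  exact ae_restrict_of_forall_mem S.isCompact_closedInterior.measurableSet hC

theorem convex_closedInterior (S : Affine.Simplex ℝ (E n) d) :
    Convex ℝ S.closedInterior := by
  rw [← Affine.Simplex.convexHull_eq_closedInterior]
  exact convex_convexHull ℝ _

/-- Change of variables for the homothety of ratio `1 / 2` centred at a point `c` of a simplex. -/
theorem setIntegral_comp_homothety_le (S : Affine.Simplex ℝ (E n) d) {c : E n}
    (hc : c ∈ S.closedInterior) {f : E n → ℝ} (hf : Continuous f) (hf0 : ∀ x, 0 ≤ f x) :
    ∫ x in S.closedInterior, f (AffineMap.homothety c (1 / 2 : ℝ) x) ∂μHE[d] ≤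
      2 ^ d * ∫ x in S.closedInterior, f x ∂μHE[d] := by
  set H : E n → E n := fun x => AffineMap.homothety c (1 / 2 : ℝ) x with hH
  have hinj : Function.Injective H := by
    intro x y hxy
    simpa [hH, AffineMap.homothety_apply] using hxy
  have hcont : Continuous H := (AffineMap.homothety c (1 / 2 : ℝ)).continuous_of_finiteDimensional
  have hemb : MeasurableEmbedding H := hcont.measurableEmbedding hinj
  have hmap : Measure.map H (μHE[d] : Measure (E n)) = (2 ^ d : NNReal) • μHE[d] := by
    ext s hs
    rw [Measure.map_apply hemb.measurable hs,
      euclideanHausdorffMeasure_homothety_preimage d c (by norm_num), Measure.smul_apply]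
    congr 2
    ext
    simp
  -- By convexity the shrunken copy stays inside; since `f ≥ 0`, its integral can then be enlarged
  -- to the whole simplex.
  have himg : H '' S.closedInterior ⊆ S.closedInterior := by
    rintro _ ⟨x, hx, rfl⟩
    have := (convex_closedInterior S) hc hx (a := 1 / 2) (b := 1 / 2) (by norm_num) (by norm_num)
      (by norm_num)
    convert this using 1
    simp only [hH, AffineMap.homothety_apply]
    simp only [vsub_eq_sub, vadd_eq_add]
    module
  have h1 := hemb.setIntegral_map (μ := (μHE[d] : Measure (E n))) f (H '' S.closedInterior)
  rw [preimage_image_eq _ hinj, hmap, Measure.restrict_smul, integral_smul_nnreal_measure] at h1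
  rw [← h1]
  have h2 : ∫ x in H '' S.closedInterior, f x ∂μHE[d] ≤ ∫ x in S.closedInterior, f x ∂μHE[d] :=
    setIntegral_mono_set (integrableOn_closedInterior S hf.continuousOn)
      (Filter.Eventually.of_forall hf0) (LE.le.eventuallyLE himg)
  rw [NNReal.smul_def, smul_eq_mul]
  push_cast
  gcongr

/-- Inverse estimate: the value of an affine map at a point of a simplex is controlled by its
`L²`-mean over the simplex. -/
theorem sq_norm_mul_measure_le (S : Affine.Simplex ℝ (E n) d) {c : E n}
    (hc : c ∈ S.closedInterior) {F : Type*} [NormedAddCommGroup F] [InnerProductSpace ℝ F]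
    (g : E n →ᵃ[ℝ] F) (hg : Continuous g) :
    ‖g c‖ ^ 2 * (μHE[d] : Measure (E n)).real S.closedInterior ≤
      (8 * 2 ^ d + 2) * ∫ x in S.closedInterior, ‖g x‖ ^ 2 ∂μHE[d] := by
  have h1 := setIntegral_comp_homothety_le S hc (f := fun x => ‖g x‖ ^ 2) (by fun_prop)
    (fun x => by positivity)
  have hH : Continuous (AffineMap.homothety c (1 / 2 : ℝ)) :=
    (AffineMap.homothety c (1 / 2 : ℝ)).continuous_of_finiteDimensional
  -- The homothety sends `x` to the midpoint of `c` and `x`, so `g c` is twice the value there minus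
  -- `g x`; then `(2a + b)² ≤ 8a² + 2b²`.
  have hpt : ∀ x, ‖g c‖ ^ 2 ≤ 8 * ‖g (AffineMap.homothety c (1 / 2 : ℝ) x)‖ ^ 2 + 2 * ‖g x‖ ^ 2 := by
    intro x
    have h2 : g c = (2 : ℝ) • g (AffineMap.homothety c (1 / 2 : ℝ) x) - g x := by
      have : g (AffineMap.homothety c (1 / 2 : ℝ) x) = (1 / 2 : ℝ) • (g x - g c) + g c := by
        rw [AffineMap.homothety_eq_lineMap, AffineMap.apply_lineMap, AffineMap.lineMap_apply]
        rfl
      rw [this]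
      module
    have h3 : ‖g c‖ ≤ 2 * ‖g (AffineMap.homothety c (1 / 2 : ℝ) x)‖ + ‖g x‖ := by
      calc ‖g c‖ = ‖(2 : ℝ) • g (AffineMap.homothety c (1 / 2 : ℝ) x) - g x‖ := by rw [← h2]
        _ ≤ _ := (norm_sub_le _ _).trans (by simp [norm_smul])
    nlinarith [norm_nonneg (g c), norm_nonneg (g x),
      norm_nonneg (g (AffineMap.homothety c (1 / 2 : ℝ) x)),
      sq_nonneg (2 * ‖g (AffineMap.homothety c (1 / 2 : ℝ) x)‖ - ‖g x‖)]
  have i1 : IntegrableOn (fun x => 8 * ‖g (AffineMap.homothety c (1 / 2 : ℝ) x)‖ ^ 2)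
      S.closedInterior μHE[d] := integrableOn_closedInterior S (by fun_prop)
  have i2 : IntegrableOn (fun x => 2 * ‖g x‖ ^ 2)
      S.closedInterior μHE[d] := integrableOn_closedInterior S (by fun_prop)
  have h4 := setIntegral_mono (μ := μHE[d]) (s := S.closedInterior)
    (f := fun _ => ‖g c‖ ^ 2)
    (integrableOn_closedInterior S continuousOn_const) (i1.add i2) hpt
  rw [setIntegral_const, smul_eq_mul] at h4
  simp only [Pi.add_apply] at h4
  rw [integral_add i1 i2, integral_const_mul, integral_const_mul] at h4
  linarith

/-- The centroid and the midpoint between centroid and vertex both have positive weights; the vertex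
is the point with parameter 2 on the line through them. -/
theorem points_mem_of_relInt_subset (S : Affine.Simplex ℝ (E n) d) (Q : AffineSubspace ℝ (E n))
    (h : relInt S ⊆ Q) (j : Fin (d + 1)) : S.points j ∈ Q := by
  set m := ((d : ℝ) + 1)⁻¹ with hm
  have hm0 : 0 < m := by positivity
  have hs : ∑ _i : Fin (d + 1), m = 1 := by
    simp [hm]
    field_simp
  let w : Fin (d + 1) → ℝ := fun _ => m
  let w' : Fin (d + 1) → ℝ := fun i => (m + if i = j then 1 else 0) / 2
  have hw' : ∑ i, w' i = 1 := by
    simp only [w']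
    rw [← Finset.sum_div, Finset.sum_add_distrib, hs]
    simp
  have h1 := h ⟨w, hs, fun i => hm0, rfl⟩
  have h2 := h ⟨w', hw', fun i => by simp only [w', mem_Ioi]; split_ifs <;> positivity, rfl⟩
  rw [Finset.affineCombination_eq_linear_combination _ _ _ hs] at h1
  rw [Finset.affineCombination_eq_linear_combination _ _ _ hw'] at h2
  have h3 := AffineMap.lineMap_mem (2 : ℝ) h1 h2
  convert h3 using 1
  rw [AffineMap.lineMap_apply]
  simp only [vsub_eq_sub, vadd_eq_add, w', add_div, add_smul, Finset.sum_add_distrib]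
  have : ∑ i, ((if i = j then (1 : ℝ) else 0) / 2) • S.points i = (1 / 2 : ℝ) • S.points j := by
    rw [Finset.sum_eq_single j] <;> simp +contextual
  rw [this]
  have : ∑ i, (m / 2) • S.points i = (1 / 2 : ℝ) • ∑ i, m • S.points i := by
    rw [Finset.smul_sum]
    refine Finset.sum_congr rfl fun i _ => ?_
    rw [smul_smul]
    congr 1
    ring
  rw [this]
  module

/-! ### Heights, normals and the Raviart-Thomas basis of a simplex -/

/-- The inverse inradius is the sum of the inverse heights, so it dominates each of them. -/
theorem inradius_le_height (S : Affine.Simplex ℝ (E n) (d + 1)) (k : Fin (d + 2)) :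
    S.inradius ≤ S.height k := by
  have h : (S.height k)⁻¹ ≤ ∑ i, (S.height i)⁻¹ :=
    Finset.single_le_sum (f := fun i => (S.height i)⁻¹)
      (fun i _ => (inv_pos.2 (S.height_pos i)).le) (Finset.mem_univ k)
  have h0 : 0 < (S.height k)⁻¹ := inv_pos.2 (S.height_pos k)
  rw [Affine.Simplex.inradius_eq_abs_inv_sum]
  simp only [Affine.Simplex.excenterWeightsUnnorm_empty_apply]
  rw [abs_of_pos (inv_pos.2 (h0.trans_le h))]
  exact inv_le_of_inv_le₀ (S.height_pos k) h

/-- On a shape-regular simplex the Raviart-Thomas basis functions are bounded. -/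
theorem norm_rtBasis_le (S : Affine.Simplex ℝ (E n) (d + 1)) {σ : ℝ}
    (hσ : Metric.diam S.closedInterior ≤ σ * (2 * S.inradius)) (k : Fin (d + 2)) {x : E n}
    (hx : x ∈ S.closedInterior) : ‖rtBasis S k x‖ ^ 2 ≤ 4 * σ ^ 2 := by
  have h1 : ‖x - S.points k‖ ≤ Metric.diam S.closedInterior := by
    rw [← dist_eq_norm]
    exact Metric.dist_le_diam_of_mem S.isCompact_closedInterior.isBounded hx
      (S.point_mem_closedInterior k)
  have hr := S.inradius_pos
  have hh := inradius_le_height S k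
  have hp := S.height_pos k
  -- No sign of `σ` is assumed; it follows from a nonnegative diameter and a positive inradius.
  have hσ0 : 0 ≤ σ := by
    by_contra hneg
    nlinarith [norm_nonneg (x - S.points k), not_le.1 hneg]
  have h2 : ‖rtBasis S k x‖ ≤ 2 * σ := by
    rw [rtBasis, norm_smul, norm_inv, Real.norm_of_nonneg hp.le, inv_mul_le_iff₀ hp]
    nlinarith
  nlinarith [norm_nonneg (rtBasis S k x)]

theorem faceOppositeCentroid_mem_affineSpan (S : Affine.Simplex ℝ (E n) (d + 1)) (k : Fin (d + 2)) :
    S.faceOppositeCentroid k ∈ affineSpan ℝ (range (S.faceOpposite k).points) :=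
  (S.faceOpposite k).centroid_mem_affineSpan

theorem faceOppositeCentroid_mem_closedInterior (S : Affine.Simplex ℝ (E n) (d + 1))
    (k : Fin (d + 2)) : S.faceOppositeCentroid k ∈ S.closedInterior := by
  refine S.closedInterior_faceOpposite_subset_closedInterior k ?_
  refine ⟨Finset.centroidWeights ℝ Finset.univ,
    Finset.sum_centroidWeights_eq_one_of_nonempty ℝ _ Finset.univ_nonempty, fun i => ?_, rfl⟩
  rw [Finset.centroidWeights_apply, mem_Icc]
  exact ⟨by positivity, inv_le_one_of_one_le₀ (by simp)⟩

theorem inner_outerNormal_eq_zero (S : Affine.Simplex ℝ (E n) (d + 1)) (k : Fin (d + 2)) {x y : E n}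
    (hx : x ∈ affineSpan ℝ (range (S.faceOpposite k).points))
    (hy : y ∈ affineSpan ℝ (range (S.faceOpposite k).points)) :
    ⟪x - y, outerNormal S k⟫ = 0 := by
  have h : S.points k - S.altitudeFoot k ∈
      (affineSpan ℝ (range (S.faceOpposite k).points)).directionᗮ :=
    EuclideanGeometry.vsub_orthogonalProjection_mem_direction_orthogonal _ _
  have h' := Submodule.inner_right_of_mem_orthogonal (AffineSubspace.vsub_mem_direction hx hy) h
  rw [outerNormal, inner_smul_right, ← neg_sub (S.points k), inner_neg_right]
  simp only [vsub_eq_sub] at h'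
  rw [h']
  simp

theorem norm_outerNormal (S : Affine.Simplex ℝ (E n) (d + 1)) (k : Fin (d + 2)) :
    ‖outerNormal S k‖ = 1 := by
  rw [outerNormal, norm_smul, norm_inv, Real.norm_of_nonneg (S.height_pos k).le,
    ← dist_eq_norm, dist_comm]
  exact inv_mul_cancel₀ (S.height_pos k).ne'

/-- This is the duality behind the basis. For `j ≠ k` the vertex `j` lies on the facet; for `j = k`
the vector is the altitude plus a vector along the facet. -/
theorem inner_sub_outerNormal (S : Affine.Simplex ℝ (E n) (d + 1)) (j k : Fin (d + 2)) :
    ⟪S.faceOppositeCentroid k - S.points j, outerNormal S k⟫ =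
      if j = k then S.height k else 0 := by
  split_ifs with h
  · subst h
    rw [← sub_add_sub_cancel _ (S.altitudeFoot j), inner_add_left,
      inner_outerNormal_eq_zero S j (faceOppositeCentroid_mem_affineSpan S j)
        (S.altitudeFoot_mem_affineSpan_faceOpposite j), zero_add]
    have hp := (S.height_pos j).ne'
    have : S.altitudeFoot j - S.points j = S.height j • outerNormal S j := by
      rw [outerNormal, smul_smul, mul_inv_cancel₀ hp, one_smul]
    rw [this, inner_smul_left, real_inner_self_eq_norm_sq, norm_outerNormal]
    simp
  · refine inner_outerNormal_eq_zero S k (faceOppositeCentroid_mem_affineSpan S k) ?_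
    refine mem_affineSpan ℝ ?_
    rw [Affine.Simplex.range_faceOpposite_points]
    exact ⟨j, h, rfl⟩

/-- The Raviart-Thomas functions form a basis dual to the fluxes. -/
theorem eq_sum_flux_smul_rtBasis (S : Affine.Simplex ℝ (E n) (d + 1)) {v : E n → E n}
    (hv : v ∈ RT0 S) (x : E n) : v x = ∑ k, flux S k v • rtBasis S k x := by
  obtain ⟨a, ha, b, hv⟩ := hv
  obtain ⟨w, hw, rfl⟩ : ∃ w : Fin (d + 2) → ℝ, ∑ i, w i = 0 ∧ a = ∑ i, w i • S.points i := by
    rw [mem_vectorSpan_iff_eq_weightedVSub] at ha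
    obtain ⟨s, w, hw, rfl⟩ := ha
    classical
    refine ⟨fun i => if i ∈ s then w i else 0, by simpa using hw, ?_⟩
    rw [Finset.weightedVSub_eq_linear_combination _ hw]
    simp [ite_smul]
  -- As the `w i` sum to zero, these coefficients sum to `b`, and the constant parts of `∑ u i • (x
  -- - S.points i)` add up to `a - b • S.points 0`.
  let u : Fin (d + 2) → ℝ := fun i => (if i = 0 then b else 0) - w i
  have hu : ∀ x, v x = ∑ i, u i • (x - S.points i) := by
    intro x
    simp only [u, hv, sub_smul, smul_sub, Finset.sum_sub_distrib, ← Finset.sum_smul, hw]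
    simp [ite_smul]
    module
  have hf : ∀ k, flux S k v = u k * S.height k := by
    intro k
    rw [flux, hu, sum_inner]
    simp [inner_smul_left, inner_sub_outerNormal]
  rw [hu]
  refine Finset.sum_congr rfl fun k _ => ?_
  rw [hf, rtBasis, smul_smul, mul_assoc, mul_inv_cancel₀ (S.height_pos k).ne', mul_one]

theorem sq_flux_le (S : Affine.Simplex ℝ (E n) (d + 1)) (k : Fin (d + 2)) (v : E n → E n) :
    flux S k v ^ 2 ≤ ‖v (S.faceOppositeCentroid k)‖ ^ 2 := by
  have h := abs_real_inner_le_norm (v (S.faceOppositeCentroid k)) (outerNormal S k)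
  rw [norm_outerNormal, mul_one] at h
  rw [flux, ← sq_abs]
  gcongr

/-- The flux of a Raviart-Thomas field through a facet is controlled by its `L²`-norm. -/
theorem sq_flux_mul_measure_le (S : Affine.Simplex ℝ (E n) (d + 1)) {v : E n → E n}
    (hv : v ∈ RT0 S) (k : Fin (d + 2)) :
    flux S k v ^ 2 * (μHE[d + 1] : Measure (E n)).real S.closedInterior ≤
      (8 * 2 ^ (d + 1) + 2) * ∫ x in S.closedInterior, ‖v x‖ ^ 2 ∂μHE[d + 1] := by
  refine (mul_le_mul_of_nonneg_right (sq_flux_le S k v) measureReal_nonneg).trans ?_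
  obtain ⟨a, ha, b, hv⟩ := hv
  let g : E n →ᵃ[ℝ] E n :=
    (b • LinearMap.id : E n →ₗ[ℝ] E n).toAffineMap + AffineMap.const ℝ _ (a - b • S.points 0)
  have hg : v = g := by
    ext1 x
    rw [hv]
    simp [g]
    module
  rw [hg]
  exact sq_norm_mul_measure_le S (faceOppositeCentroid_mem_closedInterior S k) g
    g.continuous_of_finiteDimensional

theorem RT0.continuous (S : Affine.Simplex ℝ (E n) (d + 1)) {v : E n → E n} (hv : v ∈ RT0 S) :
    Continuous v := by
  obtain ⟨a, ha, b, hv⟩ := hv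
  rw [funext hv]
  fun_prop

theorem rtBasis_continuous (S : Affine.Simplex ℝ (E n) (d + 1)) (k : Fin (d + 2)) :
    Continuous (rtBasis S k) := by
  unfold rtBasis
  fun_prop

/-- Tangency makes the projections in `massElem` act as the identity on `v`, so that the lower bound
controls the full norm of `v`. -/
theorem RT0.apply_mem (S : Affine.Simplex ℝ (E n) (d + 1)) {v : E n → E n} (hv : v ∈ RT0 S)
    {Q : AffineSubspace ℝ (E n)} (h : relInt S ⊆ Q) {x : E n} (hx : x ∈ S.closedInterior) :
    v x ∈ Q.direction := by
  have hle : affineSpan ℝ (range S.points) ≤ Q := by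
    rw [affineSpan_le]
    rintro _ ⟨j, rfl⟩
    exact points_mem_of_relInt_subset S Q h j
  obtain ⟨a, ha, b, hv⟩ := hv
  rw [hv]
  refine add_mem ?_ (Submodule.smul_mem _ _ ?_)
  · rw [← direction_affineSpan] at ha
    exact AffineSubspace.direction_le hle ha
  · exact AffineSubspace.vsub_mem_direction
      (hle (Affine.Simplex.closedInterior_subset_affineSpan hx))
      (points_mem_of_relInt_subset S Q h 0)

end Simplex

/-! ### The quadratic form of the inverse of a positive operator -/

section InverseTensor

variable {W : Type*} [NormedAddCommGroup W] [InnerProductSpace ℝ W] (L : W ≃ₗ[ℝ] W)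

theorem inner_symm_apply_comm (hs : ∀ x y, ⟪L x, y⟫ = ⟪x, L y⟫) (x y : W) :
    ⟪L.symm x, y⟫ = ⟪x, L.symm y⟫ := by
  have := hs (L.symm x) (L.symm y)
  simpa using this.symm

theorem inner_symm_smul (a : ℝ) (y : W) :
    ⟪L.symm (a • y), a • y⟫ = a ^ 2 * ⟪L.symm y, y⟫ := by
  rw [map_smul, real_inner_smul_left, real_inner_smul_right]
  ring

theorem inner_symm_apply_nonneg (hp : ∀ x, x ≠ 0 → 0 < ⟪L x, x⟫) (y : W) :
    0 ≤ ⟪L.symm y, y⟫ := by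
  rcases eq_or_ne y 0 with rfl | hy
  · simp
  · have := hp (L.symm y) (by simpa using hy)
    rw [real_inner_comm]
    simpa using this.le

/-- Cauchy-Schwarz inequality for the quadratic form of the inverse of a positive operator. -/
theorem inner_symm_sum_le (hs : ∀ x y, ⟪L x, y⟫ = ⟪x, L y⟫) (hp : ∀ x, x ≠ 0 → 0 < ⟪L x, x⟫)
    {ι : Type*} [Fintype ι] (w : ι → W) :
    ⟪L.symm (∑ k, w k), ∑ k, w k⟫ ≤ Fintype.card ι * ∑ k, ⟪L.symm (w k), w k⟫ := by
  have h2 : ∀ j k, ⟪L.symm (w j), w k⟫ ≤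
      (⟪L.symm (w j), w j⟫ + ⟪L.symm (w k), w k⟫) / 2 := by
    intro j k
    -- Nonnegativity on differences gives `2ab ≤ a² + b²` for the form.
    have h := inner_symm_apply_nonneg L hp (w j - w k)
    rw [map_sub, inner_sub_left, inner_sub_right, inner_sub_right,
      inner_symm_apply_comm L hs (w k) (w j), real_inner_comm _ (w k)] at h
    linarith
  calc ⟪L.symm (∑ k, w k), ∑ k, w k⟫ = ∑ j, ∑ k, ⟪L.symm (w j), w k⟫ := by
        rw [map_sum, sum_inner]
        simp_rw [inner_sum]
    _ ≤ ∑ j, ∑ k, (⟪L.symm (w j), w j⟫ + ⟪L.symm (w k), w k⟫) / 2 :=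
        Finset.sum_le_sum fun j _ => Finset.sum_le_sum fun k _ => h2 j k
    _ = _ := by
        simp only [← Finset.sum_div, Finset.sum_add_distrib, Finset.sum_const, Finset.card_univ,
          nsmul_eq_mul, ← Finset.mul_sum]
        ring

/-- With `x = L⁻¹ y`, coercivity gives `k‖x‖² ≤ ⟪y, x⟫ ≤ ‖y‖‖x‖`, hence `k‖x‖ ≤ ‖y‖`. -/
theorem inner_symm_apply_le {k : ℝ} (hk : 0 < k) (h : ∀ x, k * ‖x‖ ^ 2 ≤ ⟪L x, x⟫) (y : W) :
    ⟪L.symm y, y⟫ ≤ k⁻¹ * ‖y‖ ^ 2 := by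
  have h1 := h (L.symm y)
  rw [L.apply_symm_apply, real_inner_comm] at h1
  have h2 := real_inner_le_norm (L.symm y) y
  rw [inv_mul_eq_div, le_div_iff₀ hk]
  have h3 : k * ‖L.symm y‖ ≤ ‖y‖ := by
    rcases (norm_nonneg (L.symm y)).eq_or_lt with h0 | h0
    · rw [← h0]
      simp
    · refine le_of_mul_le_mul_right ?_ h0
      nlinarith
  nlinarith [norm_nonneg y]

/-- Completing the square instead of diagonalising: positivity of `L` at `L⁻¹ y - k⁻¹ y` yields
`⟪L⁻¹ y, y⟫ ≥ 2k⁻¹‖y‖² - k⁻²⟪L y, y⟫ ≥ k⁻¹‖y‖²`. -/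
theorem le_inner_symm_apply (hs : ∀ x y, ⟪L x, y⟫ = ⟪x, L y⟫) (hp : ∀ x, x ≠ 0 → 0 < ⟪L x, x⟫)
    {k : ℝ} (hk : 0 < k) (h : ∀ x, ⟪L x, x⟫ ≤ k * ‖x‖ ^ 2) (y : W) :
    ‖y‖ ^ 2 ≤ k * ⟪L.symm y, y⟫ := by
  have h1 : 0 ≤ ⟪L (L.symm y - k⁻¹ • y), L.symm y - k⁻¹ • y⟫ := by
    rcases eq_or_ne (L.symm y - k⁻¹ • y) 0 with h0 | h0
    · rw [h0]
      simp
    · exact (hp _ h0).le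
  have h2 := h y
  rw [map_sub, map_smul, L.apply_symm_apply, inner_sub_left, inner_sub_right, inner_sub_right,
    inner_smul_right, inner_smul_right, inner_smul_left, inner_smul_left, hs y (L.symm y),
    L.apply_symm_apply, real_inner_self_eq_norm_sq, real_inner_comm] at h1
  simp only [conj_trivial] at h1
  have h3 : k⁻¹ * (k⁻¹ * ⟪L y, y⟫) ≤ k⁻¹ * ‖y‖ ^ 2 := by
    have := mul_le_mul_of_nonneg_left h2 (inv_pos.2 hk).le
    rw [inv_mul_cancel_left₀ hk.ne'] at this
    exact mul_le_mul_of_nonneg_left this (inv_pos.2 hk).le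
  have h4 : k⁻¹ * ‖y‖ ^ 2 ≤ ⟪L.symm y, y⟫ := by linarith
  rwa [inv_mul_le_iff₀ hk] at h4

end InverseTensor

/-! ### Comparison of the two forms, on an element and summed over the mesh -/

namespace Mesh

variable {n : ℕ} {G : Geometry n} (M : Mesh G) (P : Parameters G)

theorem relInt_subset_plane {d : ℕ} (i : G.I d) (t : (M.sub d i).Elem) :
    relInt ((M.sub d i).simplex t) ⊆ G.plane d i := by
  obtain ⟨U, -, hU⟩ := G.dom_open d i
  refine ((M.sub d i).relInt_subset t).trans ?_
  rw [hU]
  exact inter_subset_right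

theorem continuous_massIntegrand {d : ℕ} (i : G.I (d + 1)) {u w : E n → E n} (hu : Continuous u)
    (hw : Continuous w) :
    Continuous fun x =>
      ⟪(P.K d i).symm ((G.plane (d + 1) i).direction.orthogonalProjectionOnto (u x)),
        (G.plane (d + 1) i).direction.orthogonalProjectionOnto (w x)⟫ := by
  have : Continuous (P.K d i).symm :=
    (P.K d i).symm.toLinearMap.continuous_of_finiteDimensional
  fun_prop

theorem massElem_self_nonneg {d : ℕ} (i : G.I (d + 1)) (t : (M.sub (d + 1) i).Elem)
    (u : E n → E n) : 0 ≤ M.massElem P i t u u :=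
  integral_nonneg fun _ => inner_symm_apply_nonneg _ (P.K_pos d i) _

/-- The local mass form is bounded by its diagonal. -/
theorem massElem_self_le {d : ℕ} (i : G.I (d + 1)) (t : (M.sub (d + 1) i).Elem) {v : E n → E n}
    (hv : v ∈ RT0 ((M.sub (d + 1) i).simplex t)) :
    M.massElem P i t v v ≤ (d + 2) * ∑ k, flux ((M.sub (d + 1) i).simplex t) k v ^ 2 *
      M.massElem P i t (rtBasis ((M.sub (d + 1) i).simplex t) k)
        (rtBasis ((M.sub (d + 1) i).simplex t) k) := by
  set S := (M.sub (d + 1) i).simplex t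
  have hint : ∀ k, IntegrableOn (fun x => flux S k v ^ 2 *
      ⟪(P.K d i).symm ((G.plane (d + 1) i).direction.orthogonalProjectionOnto (rtBasis S k x)),
        (G.plane (d + 1) i).direction.orthogonalProjectionOnto (rtBasis S k x)⟫)
      S.closedInterior μHE[d + 1] := fun k =>
    integrableOn_closedInterior S
      (continuous_const.mul (continuous_massIntegrand P i (rtBasis_continuous S k)
        (rtBasis_continuous S k))).continuousOn
  have hrhs : (d + 2) * ∑ k, flux S k v ^ 2 * M.massElem P i t (rtBasis S k) (rtBasis S k) =
      ∫ x in S.closedInterior, (d + 2) * ∑ k, flux S k v ^ 2 *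
        ⟪(P.K d i).symm ((G.plane (d + 1) i).direction.orthogonalProjectionOnto (rtBasis S k x)),
          (G.plane (d + 1) i).direction.orthogonalProjectionOnto (rtBasis S k x)⟫ ∂μHE[d + 1] := by
    rw [integral_const_mul, integral_finsetSum _ fun k _ => hint k]
    simp_rw [integral_const_mul]
    rfl
  rw [hrhs]
  refine setIntegral_mono (integrableOn_closedInterior S
    (continuous_massIntegrand P i (RT0.continuous S hv) (RT0.continuous S hv)).continuousOn)
    ((integrable_finsetSum _ fun k _ => hint k).const_mul _) fun x => ?_
  -- Cauchy-Schwarz at each point `x`; the factor `d + 2` is the number of facets of a `(d +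
  -- 1)`-simplex.
  have h := inner_symm_sum_le (P.K d i) (P.K_symm d i) (P.K_pos d i) fun k =>
    flux S k v • (G.plane (d + 1) i).direction.orthogonalProjectionOnto (rtBasis S k x)
  have hx := eq_sum_flux_smul_rtBasis S hv x
  simp_rw [← map_smul, ← map_sum, ← hx] at h
  refine h.trans (le_of_eq ?_)
  rw [Fintype.card_fin]
  push_cast
  congr 1
  refine Finset.sum_congr rfl fun k _ => ?_
  rw [map_smul]
  exact inner_symm_smul _ _ _

/-- On a shape-regular element the diagonal of the local mass form is bounded by the form. -/
theorem sum_sq_flux_mul_massElem_le {σ κ : ℝ} (hσ : M.ShapeRegular σ) (hκ : 1 ≤ κ)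
    (hP : P.AnisotropyLE κ) {d : ℕ} (i : G.I (d + 1)) (t : (M.sub (d + 1) i).Elem)
    {v : E n → E n} (hv : v ∈ RT0 ((M.sub (d + 1) i).simplex t)) :
    ∑ k, flux ((M.sub (d + 1) i).simplex t) k v ^ 2 *
      M.massElem P i t (rtBasis ((M.sub (d + 1) i).simplex t) k)
        (rtBasis ((M.sub (d + 1) i).simplex t) k) ≤
      (d + 2) * (8 * 2 ^ (d + 1) + 2) * (4 * σ ^ 2) * κ * M.massElem P i t v v := by
  set S := (M.sub (d + 1) i).simplex t
  obtain ⟨c, hc, hK⟩ := hP d i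
  have hκc : 0 < κ * c := by positivity
  have hmeas : MeasurableSet S.closedInterior := S.isCompact_closedInterior.measurableSet
  have hv0 := RT0.continuous S hv
  -- The upper bound `κ * c` on `K` is used here and the lower bound `c` in `hup`; in the product
  -- `c` cancels and `κ` remains.
  have hlow : ∫ x in S.closedInterior, ‖v x‖ ^ 2 ∂μHE[d + 1] ≤
      κ * c * M.massElem P i t v v := by
    rw [massElem, ← integral_const_mul]
    refine setIntegral_mono_on (integrableOn_closedInterior S (by fun_prop))
      ((integrableOn_closedInterior S
        (continuous_massIntegrand P i hv0 hv0).continuousOn).const_mul _) hmeas fun x hx => ?_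
    have h := le_inner_symm_apply (P.K d i) (P.K_symm d i) (P.K_pos d i) hκc
      (fun x => (hK x).2) ((G.plane (d + 1) i).direction.orthogonalProjectionOnto (v x))
    have hmem := RT0.apply_mem S hv (M.relInt_subset_plane i t) hx
    rwa [Submodule.coe_norm, ← Submodule.starProjection_apply,
      Submodule.starProjection_eq_self_iff.2 hmem] at h
  have hup : ∀ k, M.massElem P i t (rtBasis S k) (rtBasis S k) ≤
      c⁻¹ * (4 * σ ^ 2) * (μHE[d + 1] : Measure (E n)).real S.closedInterior := by
    intro k
    rw [massElem, mul_comm _ (Measure.real _ _), ← smul_eq_mul, ← setIntegral_const]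
    refine setIntegral_mono_on (integrableOn_closedInterior S
      (continuous_massIntegrand P i (rtBasis_continuous S k) (rtBasis_continuous S k)).continuousOn)
      (integrableOn_closedInterior S continuousOn_const) hmeas fun x hx => ?_
    refine (inner_symm_apply_le (P.K d i) hc (fun x => (hK x).1) _).trans ?_
    refine mul_le_mul_of_nonneg_left ?_ (inv_pos.2 hc).le
    refine le_trans ?_ (norm_rtBasis_le S (hσ d i t) k hx)
    gcongr
    -- For an upper bound it is enough that the projection is a contraction.
    exact Submodule.norm_orthogonalProjectionOnto_apply_le _ _
  have hk : ∀ k, flux S k v ^ 2 * M.massElem P i t (rtBasis S k) (rtBasis S k) ≤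
      (8 * 2 ^ (d + 1) + 2) * (4 * σ ^ 2) * κ * M.massElem P i t v v := by
    intro k
    calc flux S k v ^ 2 * M.massElem P i t (rtBasis S k) (rtBasis S k)
        ≤ flux S k v ^ 2 *
          (c⁻¹ * (4 * σ ^ 2) * (μHE[d + 1] : Measure (E n)).real S.closedInterior) := by
          gcongr
          exact hup k
      _ = c⁻¹ * (4 * σ ^ 2) *
          (flux S k v ^ 2 * (μHE[d + 1] : Measure (E n)).real S.closedInterior) := by ring
      _ ≤ c⁻¹ * (4 * σ ^ 2) * ((8 * 2 ^ (d + 1) + 2) * (κ * c * M.massElem P i t v v)) := by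
          refine mul_le_mul_of_nonneg_left ?_ (by positivity)
          refine (sq_flux_mul_measure_le S hv k).trans ?_
          gcongr
      _ = _ := by
          field_simp
  refine (Finset.sum_le_sum fun k _ => hk k).trans (le_of_eq ?_)
  simp only [Finset.sum_const, Finset.card_univ, Fintype.card_fin, nsmul_eq_mul]
  push_cast
  ring

theorem mortarMass_self_nonneg (μ : ∀ d, M.Lam d) : 0 ≤ M.mortarMass P μ μ := by
  refine Finset.sum_nonneg fun d _ => Finset.sum_nonneg fun f _ => ?_
  obtain ⟨m, C, hm, hb⟩ := P.Kν_bounds d f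
  have hmeas : MeasurableSet (G.Gam f) := by
    obtain ⟨U, hU, h⟩ := G.dom_open d (G.lo f)
    rw [Geometry.Gam, h]
    exact hU.measurableSet.inter (AffineSubspace.closed_of_finiteDimensional _).measurableSet
  refine setIntegral_nonneg hmeas fun x hx => ?_
  rw [mul_assoc (_ * _)]
  exact mul_nonneg (mul_nonneg (P.γ_pos d f).le (inv_nonneg.2 (hm.le.trans (hb x hx).1)))
    (mul_self_nonneg _)

variable {P}

theorem mass_self_nonneg (u : ∀ d, M.Field d) : 0 ≤ M.mass P u u :=
  Finset.sum_nonneg fun _ _ => Finset.sum_nonneg fun _ _ => Finset.sum_nonneg fun _ _ =>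
    M.massElem_self_nonneg P _ _ _

theorem massD_self_nonneg (u : ∀ d, M.Field d) : 0 ≤ M.massD P u u :=
  Finset.sum_nonneg fun _ _ => Finset.sum_nonneg fun _ _ => Finset.sum_nonneg fun _ _ =>
    Finset.sum_nonneg fun _ _ => mul_nonneg (mul_self_nonneg _) (M.massElem_self_nonneg P _ _ _)

theorem mass_self_le (hn : n ≤ 3) {u : ∀ d, M.Field d}
    (hu : ∀ d i t, u d i t ∈ RT0 ((M.sub (d + 1) i).simplex t)) :
    M.mass P u u ≤ 4 * M.massD P u u := by
  simp only [mass, massD, Finset.mul_sum]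
  refine Finset.sum_le_sum fun d hd => Finset.sum_le_sum fun i _ => Finset.sum_le_sum fun t _ => ?_
  refine (M.massElem_self_le P i t (hu d i t)).trans ?_
  simp only [← Finset.mul_sum, ← sq]
  refine mul_le_mul_of_nonneg_right ?_ (Finset.sum_nonneg fun k _ =>
    mul_nonneg (sq_nonneg _) (M.massElem_self_nonneg P _ _ _))
  -- Elements have dimension `d + 1 ≤ n ≤ 3`, hence at most 4 facets.
  have : d ≤ 2 := by
    have := Finset.mem_range.1 hd
    omega
  have : (d : ℝ) ≤ 2 := by exact_mod_cast this
  linarith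

theorem massD_self_le (hn : n ≤ 3) {σ κ : ℝ} (hσ : M.ShapeRegular σ) (hκ : 1 ≤ κ)
    (hP : P.AnisotropyLE κ) {u : ∀ d, M.Field d}
    (hu : ∀ d i t, u d i t ∈ RT0 ((M.sub (d + 1) i).simplex t)) :
    M.massD P u u ≤ 1056 * σ ^ 2 * κ * M.mass P u u := by
  simp only [mass, massD, Finset.mul_sum]
  refine Finset.sum_le_sum fun d hd => Finset.sum_le_sum fun i _ => Finset.sum_le_sum fun t _ => ?_
  simp only [← sq]
  refine (M.sum_sq_flux_mul_massElem_le P hσ hκ hP i t (hu d i t)).trans ?_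
  refine mul_le_mul_of_nonneg_right ?_ (M.massElem_self_nonneg P _ _ _)
  have hd2 : d ≤ 2 := by
    have := Finset.mem_range.1 hd
    omega
  have h1 : (d : ℝ) ≤ 2 := by exact_mod_cast hd2
  have h2 : (2 : ℝ) ^ (d + 1) ≤ 2 ^ 3 := pow_le_pow_right₀ (by norm_num) (by omega)
  -- At the largest value `d = 2` the constant is `4 * 66 * 4 = 1056`.
  calc ((d : ℝ) + 2) * (8 * 2 ^ (d + 1) + 2) * (4 * σ ^ 2) * κ
      ≤ (2 + 2) * (8 * 2 ^ 3 + 2) * (4 * σ ^ 2) * κ := by gcongr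
    _ = _ := by ring

/-- Both `v₀` and its extension part `R μ` lie in `Vh`; this makes the elementwise estimates
applicable to the total flux. -/
theorem total_mem_RT0 {R : ∀ d, M.Lam d →ₗ[ℝ] M.Field d} (hR : M.IsExtension R) {r : M.Flux}
    (hr : r ∈ M.Wh) (d : ℕ) (i : G.I (d + 1)) (t : (M.sub (d + 1) i).Elem) :
    M.total R r d i t ∈ RT0 ((M.sub (d + 1) i).simplex t) :=
  add_mem ((hr.1 d (mem_univ d)).1.1 i t) ((hR d (r.2 d)).1.1 i t)

end Mesh

end MixedDim

end

/-- The constants depend on the shape regularity `σ` of the subdomain mesh only. For a permeability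
that is a scalar multiple of the identity on each subdomain take `κ = 1`. -/
theorem mainTheorem2 (σ : ℝ) :
    ∃ c₁ c₂ : ℝ, 0 < c₁ ∧ 0 < c₂ ∧
      ∀ (n : ℕ), n = 2 ∨ n = 3 →
      ∀ (G : MixedDim.Geometry n) (M : MixedDim.Mesh G), M.ShapeRegular σ →
      ∀ (κ : ℝ), 1 ≤ κ →
      ∀ (P : MixedDim.Parameters G), P.AnisotropyLE κ →
      ∀ (R : ∀ d, M.Lam d →ₗ[ℝ] M.Field d), M.IsExtension R →
      ∀ r ∈ M.Wh,
        c₁ / Real.sqrt κ * M.normAD P R r ≤ M.normA P R r ∧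
          M.normA P R r ≤ c₂ * M.normAD P R r := by
  -- The summand 1 keeps the constant positive at `σ = 0` and, as `κ ≥ 1`, lets it absorb the mortar
  -- term.
  have hC : 0 < 1056 * σ ^ 2 + 1 := by positivity
  refine ⟨Real.sqrt (1056 * σ ^ 2 + 1)⁻¹, 2, by positivity, by norm_num, ?_⟩
  intro n hn G M hσ κ hκ P hP R hR r hr
  have hn3 : n ≤ 3 := by omega
  have hu := M.total_mem_RT0 hR hr
  have h1 := M.mass_self_le (P := P) hn3 hu
  have h2 := M.massD_self_le hn3 hσ hκ hP hu
  have h3 := M.mortarMass_self_nonneg P r.2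
  have h4 := M.mass_self_nonneg (P := P) (M.total R r)
  have hκ0 : 0 < κ := by linarith
  refine ⟨?_, ?_⟩
  -- Under the square root the claim is `aD ≤ (1056 * σ ^ 2 + 1) * κ * a`.
  · rw [MixedDim.Mesh.normAD, MixedDim.Mesh.normA, ← Real.sqrt_div (by positivity),
      ← Real.sqrt_mul (by positivity)]
    refine Real.sqrt_le_sqrt ?_
    rw [inv_eq_one_div, div_div, div_mul_eq_mul_div, one_mul, div_le_iff₀ (by positivity),
      MixedDim.Mesh.aD, MixedDim.Mesh.a]
    have h5 : 1 ≤ (1056 * σ ^ 2 + 1) * κ := by nlinarith [sq_nonneg σ]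
    have h6 : 1056 * σ ^ 2 * κ ≤ (1056 * σ ^ 2 + 1) * κ := by nlinarith
    nlinarith [mul_le_mul_of_nonneg_right h6 h4, mul_le_mul_of_nonneg_right h5 h3]
  · rw [MixedDim.Mesh.normAD, MixedDim.Mesh.normA, MixedDim.Mesh.aD, MixedDim.Mesh.a]
    rw [Real.sqrt_le_left (by positivity), mul_pow, Real.sq_sqrt
      (add_nonneg (M.massD_self_nonneg _) h3)]
    linarith
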